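/- A game is a short formal normal-play game, i.e. $G=\{G^L\mid G^R\}$ with finitely many left options $G^L$ and right options $G^R$, built recursively. Equality $G=H$ of games means equality of game values, i.e. $G\le H$ and $H\le G$, where $G\le H$ iff no $G^L$ satisfies $H\le G^L$ and no $H^R$ satisfies $H^R\le G$. The dyadic rationals $\mathbb Z[\tfrac12]$ are identified with the games that are numbers. The canonical form of an integer $n$ is given by $0=\{\ \mid\ \}$, $n+1=\{n\mid\ \}$ and $-(n+1)=\{\ \mid -n\}$ for $n\ge 0$, and that of $k/2^m$ ($k$ odd, $m\ge 1$) is $\left\{\frac{k-1}{2^m}\,\middle|\,\frac{k+1}{2^m}\right\}$ with both options in canonical form. For a game $G$ and $t\in\mathbb Z[\tfrac12]$ define $\lambda_t(G),\rho_t(G)\in\mathbb Z[\tfrac12]$, the game $G_t$ ($G$ cooled by $t$) and the temperature $t(G)\in\mathbb Z[\tfrac12]\cup\{-\infty\}$ by recursion. If $G$ is equal to an integer $n$, then $\lambda_t(G)=\rho_t(G)=n$, $G_t=n$ (in canonical form) and $t(G)=-\infty$. Otherwise let $$\widetilde\lambda_t(G)=\max_{G^L}\{\rho_t(G^L)-t\},\quad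 \widetilde\rho_t(G)=\min_{G^R}\{\lambda_t(G^R)+t\},\quad \widetilde G_t=\{(G^L)_t-t\mid (G^R)_t+t\},$$ $$t(G)=\min\{t\in\mathbb Z[\tfrac12] : \widetilde\lambda_t(G)=\widetilde\rho_t(G)\},$$ and let $\lambda_t(G),\rho_t(G),G_t$ be $\widetilde\lambda_t(G),\widetilde\rho_t(G),\widetilde G_t$ if $t\le t(G)$; if $t>t(G)$, let $\lambda_t(G)=\rho_t(G)=x$ and let $G_t$ be the canonical form of $x$, where $x=\widetilde\lambda_{t(G)}(G)=\widetilde\rho_{t(G)}(G)$. **Proposition.** 1. These definitions make sense: every game $G$ that is not equal to an integer has at least one left and one right option, and the minimum defining $t(G)$ exists. 2. For every game $G$, cooling by $0$ gives $G$ back: $G_0=G$. 3. For every odd integer $k$ and every $m\ge 1$, the canonical form $H$ of $k/2^m$ has temperature $t(H)=-\dfrac1{2^m}$. -/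

import Mathlib

namespace CGT

/-- The ring `ℤ[1/2]` of dyadic rationals, as a subring of `ℚ`. -/
def DyadicSubring : Subring ℚ where
  carrier := {q | ∃ (k : ℤ) (m : ℕ), q = k / 2 ^ m}
  zero_mem' := ⟨0, 0, by simp⟩
  one_mem' := ⟨1, 0, by simp⟩
  add_mem' := by
    rintro _ _ ⟨k, m, rfl⟩ ⟨k', m', rfl⟩
    exact ⟨k * 2 ^ m' + k' * 2 ^ m, m + m', by push_cast; field_simp; ring⟩
  mul_mem' := by
    rintro _ _ ⟨k, m, rfl⟩ ⟨k', m', rfl⟩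
    exact ⟨k * k', m + m', by push_cast; field_simp; ring⟩
  neg_mem' := by
    rintro _ ⟨k, m, rfl⟩
    exact ⟨-k, m, by push_cast; ring⟩

/-- Dyadic rationals, with the ring structure and the order inherited from `ℚ`. -/
abbrev ZHalf : Type := DyadicSubring

/-- The dyadic rational `k / 2 ^ m`. -/
def ZHalf.frac (k : ℤ) (m : ℕ) : ZHalf := ⟨(k : ℚ) / 2 ^ m, k, m, rfl⟩

/-- Formal (finite, loopfree, normal-play) games: a game `{L 0, …, L (l-1) | R 0, …, R (r-1)}`
consists of a finite family of left options and a finite family of right options, which were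
constructed before. -/
inductive Game : Type
  | mk (l r : ℕ) (L : Fin l → Game) (R : Fin r → Game) : Game

namespace Game

/-- Number of (listed) left options. -/
def numLeft : Game → ℕ
  | mk l _ _ _ => l

/-- Number of (listed) right options. -/
def numRight : Game → ℕ
  | mk _ r _ _ => r

/-- The left options. -/
def left : (G : Game) → Fin G.numLeft → Game
  | mk _ _ L _ => L

/-- The right options. -/
def right : (G : Game) → Fin G.numRight → Game
  | mk _ _ _ R => R

/-- The formal birthday; it serves as the measure for recursive definitions. -/
def birthday : Game → ℕ
  | mk _ _ L R =>
      max (Finset.univ.sup fun i => (L i).birthday + 1) (Finset.univ.sup fun j => (R j).birthday + 1)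

theorem birthday_left_lt {l r : ℕ} (L : Fin l → Game) (R : Fin r → Game) (i : Fin l) :
    (L i).birthday < (mk l r L R).birthday := by
  rw [birthday]
  have h := Finset.le_sup (f := fun i => (L i).birthday + 1) (Finset.mem_univ i)
  exact lt_of_lt_of_le (Nat.lt_succ_self _) (le_trans h (le_max_left _ _))

theorem birthday_right_lt {l r : ℕ} (L : Fin l → Game) (R : Fin r → Game) (j : Fin r) :
    (R j).birthday < (mk l r L R).birthday := by
  rw [birthday]
  have h := Finset.le_sup (f := fun j => (R j).birthday + 1) (Finset.mem_univ j)
  exact lt_of_lt_of_le (Nat.lt_succ_self _) (le_trans h (le_max_right _ _))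

/-- The order of games: `G ≤ H` iff no left option `G^L` satisfies `H ≤ G^L` and no right option
`H^R` satisfies `H^R ≤ G`. -/
def le : Game → Game → Prop
  | mk l r L R, mk l' r' L' R' =>
      (∀ i : Fin l, ¬ le (mk l' r' L' R') (L i)) ∧ (∀ j : Fin r', ¬ le (R' j) (mk l r L R))
termination_by G H => G.birthday + H.birthday
decreasing_by
  · have := birthday_left_lt L R i; omega
  · have := birthday_right_lt L' R' j; omega

instance : LE Game := ⟨le⟩

theorem le_def (G H : Game) :
    G ≤ H ↔ (∀ i, ¬ H ≤ G.left i) ∧ (∀ j, ¬ H.right j ≤ G) := by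
  cases G; cases H
  change le _ _ ↔ _
  rw [le]
  rfl

/-- Two games are equal, in the sense of having the same game value. -/
def ValEq (G H : Game) : Prop := G ≤ H ∧ H ≤ G

/-- The negative of a game: the roles of the players are exchanged. -/
def neg : Game → Game
  | mk l r L R => mk r l (fun j => (R j).neg) (fun i => (L i).neg)

instance : Neg Game := ⟨neg⟩

/-- The disjunctive sum `G + H = {G^L + H, G + H^L | G^R + H, G + H^R}`. -/
def add : Game → Game → Game
  | mk l r L R, mk l' r' L' R' =>
      mk (l + l') (r + r')
        (Fin.append (fun i => add (L i) (mk l' r' L' R')) (fun i => add (mk l r L R) (L' i)))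
        (Fin.append (fun j => add (R j) (mk l' r' L' R')) (fun j => add (mk l r L R) (R' j)))
termination_by G H => G.birthday + H.birthday
decreasing_by
  · have := birthday_left_lt L R i; omega
  · have := birthday_left_lt L' R' i; omega
  · have := birthday_right_lt L R j; omega
  · have := birthday_right_lt L' R' j; omega

instance : Add Game := ⟨add⟩

instance : Sub Game := ⟨fun G H => G + -H⟩

/-- The game `{ | }`. -/
def zero : Game := mk 0 0 Fin.elim0 Fin.elim0

/-- Canonical form of a natural number: `0 = { | }` and `n + 1 = {n | }`. -/
def ofNat : ℕ → Game
  | 0 => zero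
  | n + 1 => mk 1 0 (fun _ => ofNat n) Fin.elim0

/-- Canonical form of an integer. -/
def ofInt (n : ℤ) : Game := if 0 ≤ n then ofNat n.natAbs else -ofNat n.natAbs

/-- Canonical form of the number `k / 2 ^ m` (also where this fraction can be reduced): that of an
integer for `m = 0`, and `{(k - 1) / 2 ^ m | (k + 1) / 2 ^ m}`, with both options in canonical form,
for `k` odd and `m ≥ 1`. -/
def ofFrac : ℕ → ℤ → Game
  | 0, k => ofInt k
  | m + 1, k =>
      if Even k then ofFrac m (k / 2)
      else mk 1 1 (fun _ => ofFrac m ((k - 1) / 2)) (fun _ => ofFrac m ((k + 1) / 2))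

/-- The canonical form of a dyadic rational, whose reduced denominator is a power of `2`. -/
def ofDyadic (x : ZHalf) : Game := ofFrac (Nat.log 2 (x : ℚ).den) (x : ℚ).num

/-- `G` is equal to an integer. -/
def EqInteger (G : Game) : Prop := ∃ n : ℤ, G.ValEq (ofInt n)

end Game

/-- The data `λ_t(G)`, `ρ_t(G)`, `G_t` (as functions of `t`) and `t(G)` attached to a game `G`; the
temperature `t(G)` is in `ℤ[1/2] ∪ {-∞}`. -/
structure Thermo where
  lam : ZHalf → ZHalf
  rho : ZHalf → ZHalf
  cooled : ZHalf → Game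
  temp : WithBot ZHalf

/-- The maximum of a finite nonempty family (and `0` for the empty one). -/
def maxOf {n : ℕ} (f : Fin n → ZHalf) : ZHalf :=
  if h : (Finset.univ : Finset (Fin n)).Nonempty then Finset.univ.sup' h f else 0

/-- The minimum of a finite nonempty family (and `0` for the empty one). -/
def minOf {n : ℕ} (f : Fin n → ZHalf) : ZHalf :=
  if h : (Finset.univ : Finset (Fin n)).Nonempty then Finset.univ.inf' h f else 0

open Classical in
/-- The least element of a set of dyadic rationals (and `0` if there is none). -/
noncomputable def leastOf (S : Set ZHalf) : ZHalf :=
  if h : ∃ t, IsLeast S t then h.choose else 0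

namespace Thermo

/-- The data of a game that is equal to the integer `n`. -/
def ofInt (n : ℤ) : Thermo where
  lam _ := n
  rho _ := n
  cooled _ := Game.ofInt n
  temp := ⊥

variable {l r : ℕ} (TL : Fin l → Thermo) (TR : Fin r → Thermo)

/-- `max_{G^L} (ρ_t(G^L) - t)`, from the data of the left options. -/
def lamTilde (t : ZHalf) : ZHalf := maxOf fun i => (TL i).rho t - t

/-- `min_{G^R} (λ_t(G^R) + t)`, from the data of the right options. -/
def rhoTilde (t : ZHalf) : ZHalf := minOf fun j => (TR j).lam t + t

/-- `{(G^L)_t - t | (G^R)_t + t}`, from the data of the options. -/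
def cooledTilde (t : ZHalf) : Game :=
  .mk l r (fun i => (TL i).cooled t - Game.ofDyadic t) (fun j => (TR j).cooled t + Game.ofDyadic t)

/-- The least `t` in `ℤ[1/2]` at which the two sides of the thermograph meet. -/
noncomputable def meet : ZHalf := leastOf {t | lamTilde TL t = rhoTilde TR t}

/-- The data of a game that is not equal to an integer, from the data of its options. -/
noncomputable def ofOptions : Thermo where
  lam t := if t ≤ meet TL TR then lamTilde TL t else lamTilde TL (meet TL TR)
  rho t := if t ≤ meet TL TR then rhoTilde TR t else rhoTilde TR (meet TL TR)
  cooled t :=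
    if t ≤ meet TL TR then cooledTilde TL TR t else Game.ofDyadic (lamTilde TL (meet TL TR))
  temp := (meet TL TR : ZHalf)

end Thermo

namespace Game

open Classical in
/-- The recursive definition of `λ_t(G)`, `ρ_t(G)`, `G_t` and `t(G)`. -/
noncomputable def thermo : Game → Thermo
  | mk l r L R =>
      if h : (mk l r L R).EqInteger then Thermo.ofInt h.choose
      else Thermo.ofOptions (fun i => (L i).thermo) (fun j => (R j).thermo)

theorem thermo_of_eqInteger (G : Game) (h : G.EqInteger) : G.thermo = Thermo.ofInt h.choose := by
  cases G
  rw [thermo, dif_pos h]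

theorem thermo_of_not_eqInteger (G : Game) (h : ¬ G.EqInteger) :
    G.thermo = Thermo.ofOptions (fun i => (G.left i).thermo) (fun j => (G.right j).thermo) := by
  cases G
  rw [thermo, dif_neg h]
  rfl

/-- `λ_t(G)`. -/
noncomputable def lam (G : Game) (t : ZHalf) : ZHalf := G.thermo.lam t

/-- `ρ_t(G)`. -/
noncomputable def rho (G : Game) (t : ZHalf) : ZHalf := G.thermo.rho t

/-- `G_t`, the game `G` cooled by `t`. -/
noncomputable def cool (G : Game) (t : ZHalf) : Game := G.thermo.cooled t

/-- The temperature `t(G)`. -/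
noncomputable def temp (G : Game) : WithBot ZHalf := G.thermo.temp

/-- `max_{G^L} (ρ_t(G^L) - t)`. -/
noncomputable def lamTilde (G : Game) (t : ZHalf) : ZHalf := maxOf fun i => (G.left i).rho t - t

/-- `min_{G^R} (λ_t(G^R) + t)`. -/
noncomputable def rhoTilde (G : Game) (t : ZHalf) : ZHalf := minOf fun j => (G.right j).lam t + t

end Game

end CGT

/-! Thermographs below temperature 0 locate a game among the dyadic numbers. The central claim
(`Game.detectsAt`) is that, for every `m` and every `G`, there are integers `a`, `b` with `λ = a / 2
^ m` and `ρ = b / 2 ^ m` at `t = -1 / 2 ^ m`, such that `G ≤ k / 2 ^ m` iff `a ≤ k`, and `k / 2 ^ m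
≤ G` iff `k ≤ b`. Hence `λ = ρ` at this temperature forces `G = a / 2 ^ m`.

The induction is on `m` and, inside, on `G`. If `t(G) ≤ -1 / 2 ^ m`, the claim for `m` identifies
`G` as a multiple of `1 / 2 ^ m`. Otherwise the gap between the walls at `-1 / 2 ^ m` is at least `1
/ 2 ^ m` and closes at rate at most 2, so `t(G) ≥ -1 / 2 ^ (m + 1)` (`HasMeet.succ_le`). Then `λ`
and `ρ` at `-1 / 2 ^ (m + 1)` are computed from the options, and the simplest number principle
(`Fits.exists_valEq`) transfers the comparisons from the options to `G`.

The base case `m = 0` is proved in `tame` together with the existence of options and of the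
temperature. The temperature exists because walls are piecewise affine with dyadic breakpoints and
slopes in `{0, -1}` or `{0, 1}` (`IsWall.exists_isLeast_meet`). Cooling by 0 is immediate by
induction if `t(G) ≥ 0`; if `t(G) < 0`, some `-1 / 2 ^ m` lies above `t(G)` or equals it, and `G` is
the number on its mast. -/

namespace CGT

/-! ### Dyadic rationals and the grids of multiples of `1 / 2 ^ m` -/

namespace ZHalf

theorem coe_frac (k : ℤ) (m : ℕ) : ((frac k m : ZHalf) : ℚ) = (k : ℚ) / 2 ^ m := rfl

theorem exists_eq_frac (x : ZHalf) : ∃ (k : ℤ) (m : ℕ), x = frac k m := by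
  obtain ⟨x, k, m, h⟩ := x
  exact ⟨k, m, Subtype.ext h⟩

theorem frac_le_frac {a b : ℤ} {m : ℕ} : frac a m ≤ frac b m ↔ a ≤ b := by
  rw [← Subtype.coe_le_coe, coe_frac, coe_frac, div_le_div_iff_of_pos_right (by positivity)]
  exact_mod_cast Iff.rfl

theorem frac_lt_frac {a b : ℤ} {m : ℕ} : frac a m < frac b m ↔ a < b := by
  rw [← not_le, frac_le_frac, not_le]

theorem frac_inj {a b : ℤ} {m : ℕ} : frac a m = frac b m ↔ a = b := by
  simp only [le_antisymm_iff, frac_le_frac]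

theorem frac_add (a b : ℤ) (m : ℕ) : frac (a + b) m = frac a m + frac b m := by
  apply Subtype.ext
  simp only [Subring.coe_add, coe_frac]
  push_cast
  ring

theorem frac_neg (a : ℤ) (m : ℕ) : frac (-a) m = -frac a m := by
  apply Subtype.ext
  simp only [Subring.coe_neg, coe_frac]
  push_cast
  ring

theorem frac_sub (a b : ℤ) (m : ℕ) : frac (a - b) m = frac a m - frac b m := by
  rw [sub_eq_add_neg, frac_add, frac_neg, sub_eq_add_neg]

theorem frac_zero_left (m : ℕ) : frac 0 m = 0 := by
  apply Subtype.ext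
  simp [coe_frac]

theorem frac_zero_right (k : ℤ) : frac k 0 = k := by
  apply Subtype.ext
  simp [coe_frac]

theorem frac_mul_pow (k : ℤ) (m n : ℕ) : frac (k * 2 ^ n) (m + n) = frac k m := by
  apply Subtype.ext
  simp only [coe_frac]
  push_cast
  field_simp
  ring

theorem frac_two_mul (k : ℤ) (m : ℕ) : frac (2 * k) (m + 1) = frac k m := by
  rw [← frac_mul_pow k m 1, pow_one, mul_comm]

theorem frac_one_pos (m : ℕ) : 0 < frac 1 m := by
  rw [← frac_zero_left m, frac_lt_frac]
  norm_num

theorem frac_one_succ (m : ℕ) : frac 1 m = frac 1 (m + 1) + frac 1 (m + 1) := by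
  rw [← frac_two_mul, ← frac_add]
  norm_num

theorem exists_le_frac (t : ZHalf) (m : ℕ) : ∃ k, t ≤ frac k m := by
  obtain ⟨n, hn⟩ := exists_nat_ge ((t : ℚ) * 2 ^ m)
  refine ⟨n, ?_⟩
  rw [← Subtype.coe_le_coe, coe_frac, le_div_iff₀ (by positivity)]
  exact_mod_cast hn

theorem exists_frac_neg_one_ge {t : ZHalf} (ht : t < 0) : ∃ m, t ≤ frac (-1) m := by
  obtain ⟨k, m, rfl⟩ := exists_eq_frac t
  rw [← frac_zero_left m, frac_lt_frac] at ht
  exact ⟨m, frac_le_frac.2 (by omega)⟩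

/-- The multiples of `1 / 2 ^ m`. -/
def grid (m : ℕ) : AddSubgroup ZHalf where
  carrier := {x | ∃ k, x = frac k m}
  zero_mem' := ⟨0, (frac_zero_left m).symm⟩
  add_mem' := by
    rintro _ _ ⟨a, rfl⟩ ⟨b, rfl⟩
    exact ⟨a + b, (frac_add a b m).symm⟩
  neg_mem' := by
    rintro _ ⟨a, rfl⟩
    exact ⟨-a, (frac_neg a m).symm⟩

theorem frac_mem_grid (k : ℤ) (m : ℕ) : frac k m ∈ grid m := ⟨k, rfl⟩

theorem grid_mono {m n : ℕ} (h : m ≤ n) : grid m ≤ grid n := by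
  rintro _ ⟨k, rfl⟩
  obtain ⟨d, rfl⟩ := Nat.exists_eq_add_of_le h
  exact ⟨_, (frac_mul_pow k m d).symm⟩

theorem intCast_mem_grid (n : ℤ) (m : ℕ) : (n : ZHalf) ∈ grid m := by
  rw [← frac_zero_right]
  exact grid_mono (Nat.zero_le m) (frac_mem_grid n 0)

theorem le_of_mem_grid_of_pos {x : ZHalf} {m : ℕ} (hx : x ∈ grid m) (h : 0 < x) :
    frac 1 m ≤ x := by
  obtain ⟨k, rfl⟩ := hx
  rw [← frac_zero_left m, frac_lt_frac] at h
  rw [frac_le_frac]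
  omega

end ZHalf

open ZHalf

theorem maxOf_spec {n : ℕ} (hn : 0 < n) (f : Fin n → ZHalf) :
    (∃ i, maxOf f = f i) ∧ ∀ i, f i ≤ maxOf f := by
  have h : (Finset.univ : Finset (Fin n)).Nonempty := ⟨⟨0, hn⟩, Finset.mem_univ _⟩
  rw [maxOf, dif_pos h]
  refine ⟨?_, fun i => Finset.le_sup' f (Finset.mem_univ i)⟩
  obtain ⟨i, -, hi⟩ := Finset.exists_mem_eq_sup' h f
  exact ⟨i, hi⟩

theorem minOf_spec {n : ℕ} (hn : 0 < n) (f : Fin n → ZHalf) :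
    (∃ i, minOf f = f i) ∧ ∀ i, minOf f ≤ f i := by
  have h : (Finset.univ : Finset (Fin n)).Nonempty := ⟨⟨0, hn⟩, Finset.mem_univ _⟩
  rw [minOf, dif_pos h]
  refine ⟨?_, fun i => Finset.inf'_le f (Finset.mem_univ i)⟩
  obtain ⟨i, -, hi⟩ := Finset.exists_mem_eq_inf' h f
  exact ⟨i, hi⟩

theorem neg_minOf {n : ℕ} (hn : 0 < n) (f : Fin n → ZHalf) :
    -minOf f = maxOf fun i => -f i := by
  obtain ⟨⟨i, hi⟩, h⟩ := minOf_spec hn f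
  obtain ⟨⟨j, hj⟩, h'⟩ := maxOf_spec hn fun i => -f i
  have h1 := h j
  have h2 := h' i
  linarith

theorem leastOf_eq {S : Set ZHalf} {T : ZHalf} (h : IsLeast S T) : leastOf S = T := by
  have hex : ∃ t, IsLeast S t := ⟨T, h⟩
  rw [leastOf, dif_pos hex]
  exact hex.choose_spec.unique h

/-! ### Walls of thermographs and where they meet -/

/-- The functions of temperature that bound thermographs on the left: piecewise affine functions
with slopes `0` and `-1` whose pieces have their ends on the grid of mesh `1 / 2 ^ N`. -/
structure IsWall (N : ℕ) (f : ZHalf → ZHalf) : Prop where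
  antitone : Antitone f
  monotone_add : Monotone fun t => f t + t
  mem_grid : ∀ M, N ≤ M → ∀ t ∈ grid M, f t ∈ grid M

namespace IsWall

variable {N : ℕ} {f g : ZHalf → ZHalf}

theorem mono {M : ℕ} (hf : IsWall N f) (h : N ≤ M) : IsWall M f :=
  ⟨hf.antitone, hf.monotone_add, fun K hK => hf.mem_grid K (h.trans hK)⟩

theorem const {c : ZHalf} (hc : c ∈ grid N) : IsWall N fun _ => c :=
  ⟨antitone_const, fun _ _ h => by simpa using h, fun _ hM _ _ => grid_mono hM hc⟩

/-- Right walls are treated as negatives of left walls. This one operation then serves both sides: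
it takes `-ρ` to `ρ - t`, and `λ` to `-(λ + t)`. -/
theorem neg_sub_id (hf : IsWall N f) : IsWall N fun t => -f t - t := by
  refine ⟨fun s t h => ?_, fun s t h => ?_, fun M hM t ht => ?_⟩
  · have := hf.monotone_add h
    dsimp only at this ⊢
    linarith
  · have := hf.antitone h
    dsimp only
    linarith
  · exact sub_mem (neg_mem (hf.mem_grid M hM t ht)) ht

theorem max {n : ℕ} (hn : 0 < n) {f : Fin n → ZHalf → ZHalf} (hf : ∀ i, IsWall N (f i)) :
    IsWall N fun t => maxOf fun i => f i t := by
  refine ⟨fun s t h => ?_, fun s t h => ?_, fun M hM t ht => ?_⟩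
  · obtain ⟨⟨i, hi⟩, -⟩ := maxOf_spec hn fun i => f i t
    have h1 := (maxOf_spec hn fun i => f i s).2 i
    have := (hf i).antitone h
    rw [hi]
    exact this.trans h1
  · obtain ⟨⟨i, hi⟩, -⟩ := maxOf_spec hn fun i => f i s
    have h1 := (maxOf_spec hn fun i => f i t).2 i
    have := (hf i).monotone_add h
    dsimp only at this ⊢
    rw [hi]
    linarith
  · obtain ⟨⟨i, hi⟩, -⟩ := maxOf_spec hn fun i => f i t
    rw [hi]
    exact (hf i).mem_grid M hM t ht

/-- Stopping at `T` produces the vertical mast: `λ_t` is `λ̃` evaluated at `min t T`. -/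
theorem comp_min (hf : IsWall N f) {T : ZHalf} (hT : T ∈ grid N) :
    IsWall N fun t => f (min t T) := by
  refine ⟨fun s t h => hf.antitone (min_le_min_right T h), fun s t h => ?_, fun M hM t ht => ?_⟩
  · have h1 := hf.monotone_add (min_le_min_right T h)
    dsimp only at h1 ⊢
    rcases le_total s T with hs | hs <;> rcases le_total t T with ht | ht <;>
      simp only [min_eq_left, min_eq_right, hs, ht] at h1 ⊢ <;> linarith
  · refine hf.mem_grid M hM _ ?_
    rcases min_choice t T with h | h <;> rw [h]
    exacts [ht, grid_mono hM hT]

/-- Over one mesh `f` drops by a grid multiple between 0 and `1 / 2 ^ N`, hence by one of these two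
extremes. Either extreme leaves no freedom in between, by the two monotonicity conditions. -/
theorem affine (hf : IsWall N f) {p : ZHalf} (hp : p ∈ grid N) :
    (∀ t, p ≤ t → t ≤ p + frac 1 N → f t = f p) ∨
      ∀ t, p ≤ t → t ≤ p + frac 1 N → f t = f p - (t - p) := by
  have hq : p + frac 1 N ∈ grid N := add_mem hp (frac_mem_grid 1 N)
  have hpq : p ≤ p + frac 1 N := le_add_of_nonneg_right (frac_one_pos N).le
  have hd := sub_mem (hf.mem_grid N le_rfl p hp) (hf.mem_grid N le_rfl _ hq)
  have h1 := hf.antitone hpq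
  rcases h1.eq_or_lt with h | h
  · left
    intro t h2 h3
    exact le_antisymm (hf.antitone h2) (h ▸ hf.antitone h3)
  · right
    intro t h2 h3
    have h4 := le_of_mem_grid_of_pos hd (sub_pos.2 h)
    have h5 := hf.monotone_add h2
    have h6 := hf.monotone_add h3
    dsimp only at h5 h6
    linarith

theorem antitone_sub (hf : IsWall N f) (hg : IsWall N fun t => -g t) :
    Antitone fun t => f t - g t := by
  intro s t h
  have h1 := hf.antitone h
  have h2 := hg.antitone h
  dsimp only at h2 ⊢
  linarith

/-- The gap `f - g` is antitone, so the first meeting lies in the mesh interval that ends at the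
first grid point where the gap is no longer positive. Both walls are affine there. -/
theorem exists_isLeast_meet (hf : IsWall N f) (hg : IsWall N fun t => -g t)
    {t₀ t₁ : ZHalf} (h₀ : g t₀ < f t₀) (h₁ : f t₁ < g t₁) :
    ∃ T ∈ grid (N + 1), IsLeast {t | f t = g t} T := by
  have hanti := hf.antitone_sub hg
  obtain ⟨k₁, hk₁⟩ := exists_le_frac t₁ N
  obtain ⟨k₀, hk₀⟩ := exists_le_frac (-t₀) N
  have hbdd : ∀ k : ℤ, f (frac k N) ≤ g (frac k N) → -k₀ ≤ k := by
    intro k hk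
    by_contra! hlt
    have h1 := frac_le_frac (m := N).2 hlt.le
    rw [frac_neg] at h1
    have h2 := hanti (show frac k N ≤ t₀ by linarith)
    dsimp only at h2
    linarith
  have hne : ∃ k : ℤ, f (frac k N) ≤ g (frac k N) := by
    refine ⟨k₁, ?_⟩
    have h2 := hanti hk₁
    dsimp only at h2
    linarith
  obtain ⟨k, hk, hmin⟩ := Int.exists_least_of_bdd ⟨-k₀, hbdd⟩ hne
  set p := frac (k - 1) N with hp
  have hpk : frac k N = p + frac 1 N := by rw [hp, ← frac_add]; norm_num
  have hfp : g p < f p := by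
    by_contra! h
    have := hmin _ h
    omega
  have hpg : p ∈ grid N := frac_mem_grid _ N
  have hfg : f p - g p ∈ grid N := by
    have := add_mem (hf.mem_grid N le_rfl p hpg) (hg.mem_grid N le_rfl p hpg)
    rwa [← sub_eq_add_neg] at this
  have hu := frac_one_pos N
  have hv := frac_one_pos (N + 1)
  have huv := frac_one_succ N
  have hge := le_of_mem_grid_of_pos hfg (sub_pos.2 hfp)
  rw [hpk] at hk
  have hN : grid N ≤ grid (N + 1) := grid_mono (Nat.le_succ N)
  have key : ∀ T, p ≤ T → f T = g T → (∀ t, p < t → t < T → f t ≠ g t) →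
      IsLeast {t | f t = g t} T := by
    intro T _ hT h
    refine ⟨hT, fun t (ht : f t = g t) => ?_⟩
    by_contra! hlt
    rcases le_or_gt t p with h1 | h1
    · have h2 := hanti h1
      dsimp only at h2
      linarith
    · exact h t h1 hlt ht
  rcases hf.affine hpg with hf' | hf' <;> rcases hg.affine hpg with hg' | hg'
  · have h1 := hf' _ (by linarith) le_rfl
    have h2 := hg' _ (by linarith) le_rfl
    linarith
  · refine ⟨p + frac 1 N, hN (add_mem hpg (frac_mem_grid 1 N)), key _ (by linarith) ?_ ?_⟩
    · have h1 := hf' _ (by linarith) le_rfl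
      have h2 := hg' _ (by linarith) le_rfl
      linarith
    · intro t h1 h2 h3
      have h4 := hf' t h1.le h2.le
      have h5 := hg' t h1.le h2.le
      linarith
  · refine ⟨p + frac 1 N, hN (add_mem hpg (frac_mem_grid 1 N)), key _ (by linarith) ?_ ?_⟩
    · have h1 := hf' _ (by linarith) le_rfl
      have h2 := hg' _ (by linarith) le_rfl
      linarith
    · intro t h1 h2 h3
      have h4 := hf' t h1.le h2.le
      have h5 := hg' t h1.le h2.le
      linarith
  -- Here the gap closes at rate 2. A gap of one mesh closes at the midpoint, which is why `T` needs
  -- the grid `N + 1`; a larger one is at least two meshes and closes at the right end.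
  · rcases hge.eq_or_lt with h | h
    · refine ⟨p + frac 1 (N + 1), add_mem (hN hpg) (frac_mem_grid 1 _), key _ (by linarith) ?_ ?_⟩
      · have h1 := hf' (p + frac 1 (N + 1)) (by linarith) (by linarith)
        have h2 := hg' (p + frac 1 (N + 1)) (by linarith) (by linarith)
        linarith
      · intro t h1 h2 h3
        have h4 := hf' t h1.le (by linarith)
        have h5 := hg' t h1.le (by linarith)
        linarith
    · have h6 := le_of_mem_grid_of_pos (sub_mem hfg (frac_mem_grid 1 N)) (sub_pos.2 h)
      refine ⟨p + frac 1 N, hN (add_mem hpg (frac_mem_grid 1 N)), key _ (by linarith) ?_ ?_⟩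
      · have h1 := hf' _ (by linarith) le_rfl
        have h2 := hg' _ (by linarith) le_rfl
        linarith
      · intro t h1 h2 h3
        have h4 := hf' t h1.le h2.le
        have h5 := hg' t h1.le h2.le
        linarith

end IsWall

end CGT

namespace CGT

/-! ### The order of games -/

namespace Game

theorem option_induction {P : Game → Prop}
    (h : ∀ G : Game, (∀ i, P (G.left i)) → (∀ j, P (G.right j)) → P G) (G : Game) : P G := by
  induction G with
  | mk l r L R ihL ihR => exact h (mk l r L R) ihL ihR

theorem birthday_left (G : Game) (i : Fin G.numLeft) : (G.left i).birthday < G.birthday := by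
  cases G
  exact birthday_left_lt _ _ i

theorem birthday_right (G : Game) (j : Fin G.numRight) : (G.right j).birthday < G.birthday := by
  cases G
  exact birthday_right_lt _ _ j

protected theorem le_refl (G : Game) : G ≤ G := by
  induction G using option_induction with
  | h G ihL ihR =>
    refine (le_def G G).2 ⟨fun i h => ?_, fun j h => ?_⟩
    · exact ((le_def _ _).1 h).1 i (ihL i)
    · exact ((le_def _ _).1 h).2 j (ihR j)

theorem not_le_left (G : Game) (i : Fin G.numLeft) : ¬ G ≤ G.left i :=
  ((le_def G G).1 G.le_refl).1 i

theorem not_right_le (G : Game) (j : Fin G.numRight) : ¬ G.right j ≤ G :=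
  ((le_def G G).1 G.le_refl).2 j

protected theorem le_trans {A B C : Game} (h₁ : A ≤ B) (h₂ : B ≤ C) : A ≤ C := by
  induction hn : A.birthday + B.birthday + C.birthday using Nat.strong_induction_on
    generalizing A B C with
  | _ n ih =>
    refine (le_def A C).2 ⟨fun i h => ?_, fun j h => ?_⟩
    · have := A.birthday_left i
      exact ((le_def A B).1 h₁).1 i (ih _ (by omega) h₂ h rfl)
    · have := C.birthday_right j
      exact ((le_def B C).1 h₂).2 j (ih _ (by omega) h h₁ rfl)

theorem ValEq.symm {G H : Game} (h : G.ValEq H) : H.ValEq G := ⟨h.2, h.1⟩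

theorem ValEq.trans {A B C : Game} (h₁ : A.ValEq B) (h₂ : B.ValEq C) : A.ValEq C :=
  ⟨Game.le_trans h₁.1 h₂.1, Game.le_trans h₂.2 h₁.2⟩

theorem mk_valEq (G : Game) {L : Fin G.numLeft → Game} {R : Fin G.numRight → Game}
    (hL : ∀ i, (L i).ValEq (G.left i)) (hR : ∀ j, (R j).ValEq (G.right j)) :
    (mk _ _ L R).ValEq G := by
  refine ⟨(le_def _ _).2 ⟨fun i h => ?_, fun j h => ?_⟩,
    (le_def _ _).2 ⟨fun i h => ?_, fun j h => ?_⟩⟩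
  · exact G.not_le_left i (Game.le_trans h (hL i).1)
  · exact (mk _ _ L R).not_right_le j (Game.le_trans (hR j).1 h)
  · exact (mk _ _ L R).not_le_left i (Game.le_trans h (hL i).2)
  · exact G.not_right_le j (Game.le_trans (hR j).2 h)

theorem add_zero (G : Game) : G + zero = G := by
  induction G with
  | mk l r L R ihL ihR =>
    change add _ _ = _
    rw [zero, add]
    have hL : (fun i => add (L i) zero) = L := funext ihL
    have hR : (fun j => add (R j) zero) = R := funext ihR
    rw [zero] at hL hR
    rw [hL, hR]
    congr 1
    · refine funext fun i => ?_
      exact Fin.append_left L _ i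
    · refine funext fun i => ?_
      exact Fin.append_left R _ i

theorem neg_zero : -zero = zero := by
  change neg zero = zero
  rw [zero, neg]
  congr 1 <;> exact funext fun i => i.elim0

theorem sub_zero (G : Game) : G - zero = G := by
  change G + -zero = G
  rw [neg_zero, add_zero]

/-- Numbers: games in which, hereditarily, no right option is at most a left option. -/
inductive Numeric : Game → Prop
  | intro (G : Game) (h : ∀ i j, ¬ G.right j ≤ G.left i) (hL : ∀ i, Numeric (G.left i))
      (hR : ∀ j, Numeric (G.right j)) : Numeric G

theorem Numeric.left_le {G : Game} (h : G.Numeric) (i : Fin G.numLeft) : G.left i ≤ G := by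
  induction h with
  | intro G h _ _ ihL _ =>
    refine (le_def _ _).2 ⟨fun i' h' => ?_, fun j => h i j⟩
    exact G.not_le_left i (Game.le_trans h' (ihL i i'))

theorem Numeric.le_right {G : Game} (h : G.Numeric) (j : Fin G.numRight) : G ≤ G.right j := by
  induction h with
  | intro G h _ _ _ ihR =>
    refine (le_def _ _).2 ⟨fun i => h i j, fun j' h' => ?_⟩
    exact G.not_right_le j (Game.le_trans (ihR j j') h')

/-! ### Canonical forms of dyadic numbers and their order -/

theorem ofInt_natCast (n : ℕ) : ofInt n = ofNat n := by
  simp [ofInt]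

theorem ofInt_neg_natCast (n : ℕ) : ofInt (-n) = -ofNat n := by
  rcases n with _ | n
  · exact neg_zero.symm
  · rw [ofInt, if_neg (by push_cast; omega), Int.natAbs_neg, Int.natAbs_natCast]

theorem ofInt_natCast_succ (n : ℕ) :
    ofInt (n + 1) = mk 1 0 (fun _ => ofInt n) Fin.elim0 := by
  rw [ofInt_natCast]
  exact ofInt_natCast (n + 1)

theorem ofInt_neg_natCast_succ (n : ℕ) :
    ofInt (-(n + 1)) = mk 0 1 Fin.elim0 (fun _ => ofInt (-n)) := by
  have h := ofInt_neg_natCast (n + 1)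
  push_cast at h
  rw [h, ofInt_neg_natCast]
  change neg (ofNat (n + 1)) = _
  rw [ofNat, neg]
  congr 1
  exact funext fun i => i.elim0

theorem ofFrac_even {m : ℕ} {k : ℤ} (hk : Even k) : ofFrac (m + 1) k = ofFrac m (k / 2) := by
  rw [ofFrac, if_pos hk]

theorem ofFrac_two_mul (m : ℕ) (k : ℤ) : ofFrac (m + 1) (2 * k) = ofFrac m k := by
  rw [ofFrac_even (even_two_mul k), Int.mul_ediv_cancel_left _ two_ne_zero]

theorem ofFrac_two_mul_add_one (m : ℕ) (k : ℤ) :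
    ofFrac (m + 1) (2 * k + 1) = mk 1 1 (fun _ => ofFrac m k) (fun _ => ofFrac m (k + 1)) := by
  rw [ofFrac, if_neg (by simp)]
  congr 2 <;> funext _ <;> congr 1 <;> omega

theorem ofFrac_mul_pow (k : ℤ) (m : ℕ) : ofFrac m (k * 2 ^ m) = ofInt k := by
  induction m with
  | zero => simp [ofFrac]
  | succ m ih => rw [pow_succ, ← mul_assoc, mul_comm, ofFrac_two_mul, ih]

/-- Strict monotonicity of `ofFrac m` follows, since a number lies strictly between its options. -/
theorem ofFrac_adjacent (m : ℕ) (k : ℤ) :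
    (∃ i, (ofFrac m (k + 1)).left i = ofFrac m k) ∨
      ∃ j, (ofFrac m k).right j = ofFrac m (k + 1) := by
  rcases m with _ | m
  · simp only [ofFrac]
    rcases le_or_gt 0 k with h | h
    · lift k to ℕ using h
      left
      rw [ofInt_natCast_succ]
      exact ⟨(0 : Fin 1), rfl⟩
    · obtain ⟨n, rfl⟩ : ∃ n : ℕ, k = -(n + 1) := ⟨(-k - 1).toNat, by omega⟩
      right
      rw [ofInt_neg_natCast_succ]
      exact ⟨(0 : Fin 1), by simp [right]⟩
  · obtain ⟨a, rfl | rfl⟩ := k.even_or_odd'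
    · left
      rw [ofFrac_two_mul_add_one, ofFrac_two_mul]
      exact ⟨(0 : Fin 1), rfl⟩
    · right
      rw [ofFrac_two_mul_add_one, show 2 * a + 1 + 1 = 2 * (a + 1) by ring, ofFrac_two_mul]
      exact ⟨(0 : Fin 1), rfl⟩

theorem ofInt_numeric (n : ℤ) : (ofInt n).Numeric := by
  induction n using Int.induction_on with
  | zero => exact .intro _ (fun i => i.elim0) (fun i => i.elim0) (fun i => i.elim0)
  | succ n ih =>
    rw [ofInt_natCast_succ]
    exact .intro _ (fun _ j => j.elim0) (fun _ => ih) (fun j => j.elim0)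
  | pred n ih =>
    rw [show -(n : ℤ) - 1 = -(n + 1) by ring, ofInt_neg_natCast_succ]
    exact .intro _ (fun i => i.elim0) (fun i => i.elim0) (fun _ => ih)

theorem ofFrac_lt_succ_of_numeric {m : ℕ} (h : ∀ k, (ofFrac m k).Numeric) (k : ℤ) :
    ofFrac m k ≤ ofFrac m (k + 1) ∧ ¬ ofFrac m (k + 1) ≤ ofFrac m k := by
  rcases ofFrac_adjacent m k with ⟨i, hi⟩ | ⟨j, hj⟩
  · exact hi ▸ ⟨(h _).left_le i, not_le_left _ i⟩
  · exact hj ▸ ⟨(h _).le_right j, not_right_le _ j⟩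

theorem ofFrac_numeric (m : ℕ) (k : ℤ) : (ofFrac m k).Numeric := by
  induction m generalizing k with
  | zero => exact ofInt_numeric k
  | succ m ih =>
    obtain ⟨a, rfl | rfl⟩ := k.even_or_odd'
    · rw [ofFrac_two_mul]
      exact ih a
    · rw [ofFrac_two_mul_add_one]
      exact .intro _ (fun _ _ => (ofFrac_lt_succ_of_numeric ih a).2) (fun _ => ih _) (fun _ => ih _)

theorem ofFrac_mono {m : ℕ} {a b : ℤ} (h : a ≤ b) : ofFrac m a ≤ ofFrac m b := by
  induction b, h using Int.leInduction with
  | base => exact Game.le_refl _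
  | succ b _ ih => exact Game.le_trans ih (ofFrac_lt_succ_of_numeric (ofFrac_numeric m) b).1

theorem ofFrac_le_ofFrac {m : ℕ} {a b : ℤ} : ofFrac m a ≤ ofFrac m b ↔ a ≤ b := by
  refine ⟨fun h => ?_, ofFrac_mono⟩
  by_contra! hlt
  exact (ofFrac_lt_succ_of_numeric (ofFrac_numeric m) b).2
    (Game.le_trans (ofFrac_mono hlt) h)

theorem ofDyadic_frac (k : ℤ) (m : ℕ) : ofDyadic (ZHalf.frac k m) = ofFrac m k := by
  induction m generalizing k with
  | zero => simp [ofDyadic, ZHalf.frac]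
  | succ m ih =>
    obtain ⟨a, rfl | rfl⟩ := k.even_or_odd'
    · rw [ofFrac_two_mul, ← ih]
      congr 1
      apply Subtype.ext
      simp only [ZHalf.frac]
      push_cast
      field_simp
      ring
    · have hc : Nat.Coprime (2 * a + 1).natAbs ((2 : ℤ) ^ (m + 1)).natAbs := by
        rw [Int.natAbs_pow]
        refine Nat.Coprime.pow_right _ ?_
        refine Nat.coprime_two_right.2 ?_
        rw [Nat.odd_iff]
        omega
      have hp : (0 : ℤ) < 2 ^ (m + 1) := by positivity
      have hn := Rat.num_div_eq_of_coprime hp hc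
      have hd := Rat.den_div_eq_of_coprime hp hc
      push_cast at hn hd
      have hd' : (((2 * a + 1 : ℤ) : ℚ) / 2 ^ (m + 1)).den = 2 ^ (m + 1) := by
        push_cast
        exact_mod_cast hd
      rw [ofDyadic, ZHalf.frac]
      dsimp only
      rw [hd', Nat.log_pow (by norm_num)]
      push_cast
      rw [hn]

/-! ### The simplest number principle -/

/-- `x` lies strictly between the left and the right options of `G`. -/
def Fits (x G : Game) : Prop := (∀ i, ¬ x ≤ G.left i) ∧ ∀ j, ¬ G.right j ≤ x

/-- If `G ≤ x` fails although no left option of `G` is `≥ x`, then some `x^R ≤ G`, and this `x^R`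
fits as well; dually for `x ≤ G`. Descending through options must end with equality. -/
theorem fits_or_valEq {x G : Game} (hx : x.Numeric) (h : Fits x G) :
    G.ValEq x ∨ (∃ i, Fits (x.left i) G) ∨ ∃ j, Fits (x.right j) G := by
  by_cases h₁ : G ≤ x
  · by_cases h₂ : x ≤ G
    · exact .inl ⟨h₁, h₂⟩
    · rw [le_def] at h₂
      push Not at h₂
      obtain ⟨i, hi⟩ : ∃ i, G ≤ x.left i := by
        by_contra! hn
        obtain ⟨j, hj⟩ := h₂ hn
        exact h.2 j hj
      refine .inr (.inl ⟨i, fun i' h' => ?_, fun j h' => ?_⟩)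
      · exact G.not_le_left i' (Game.le_trans hi h')
      · exact h.2 j (Game.le_trans h' (hx.left_le i))
  · rw [le_def] at h₁
    push Not at h₁
    obtain ⟨j, hj⟩ := h₁ h.1
    refine .inr (.inr ⟨j, fun i h' => ?_, fun j' h' => ?_⟩)
    · exact h.1 i (Game.le_trans (hx.le_right j) h')
    · exact G.not_right_le j' (Game.le_trans h' hj)

theorem Fits.exists_valEq_ofInt {n : ℤ} {G : Game} (h : Fits (ofInt n) G) :
    ∃ k, G.ValEq (ofInt k) := by
  induction n using Int.induction_on with
  | zero =>
    rcases fits_or_valEq (ofInt_numeric 0) h with h | ⟨i, -⟩ | ⟨j, -⟩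
    exacts [⟨_, h⟩, i.elim0, j.elim0]
  | succ n ih =>
    have h' := fits_or_valEq (ofInt_numeric _) h
    rw [ofInt_natCast_succ] at h'
    rcases h' with h' | ⟨i, h'⟩ | ⟨j, -⟩
    exacts [⟨n + 1, by rwa [ofInt_natCast_succ]⟩, ih h', j.elim0]
  | pred n ih =>
    have h' := fits_or_valEq (ofInt_numeric _) h
    rw [show -(n : ℤ) - 1 = -(n + 1) by ring, ofInt_neg_natCast_succ] at h'
    rcases h' with h' | ⟨i, -⟩ | ⟨j, h'⟩
    exacts [⟨-(n + 1), by rwa [ofInt_neg_natCast_succ]⟩, i.elim0, ih h']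

theorem Fits.exists_valEq {m : ℕ} {k : ℤ} {G : Game} (h : Fits (ofFrac m k) G) :
    ∃ j, G.ValEq (ofFrac m j) := by
  induction m generalizing k with
  | zero => exact h.exists_valEq_ofInt
  | succ m ih =>
    have lift : (∃ j, G.ValEq (ofFrac m j)) → ∃ j, G.ValEq (ofFrac (m + 1) j) :=
      fun ⟨j, hj⟩ => ⟨2 * j, by rwa [ofFrac_two_mul]⟩
    obtain ⟨a, rfl | rfl⟩ := k.even_or_odd'
    · rw [ofFrac_two_mul] at h
      exact lift (ih h)
    · have h' := fits_or_valEq (ofFrac_numeric _ _) h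
      rw [ofFrac_two_mul_add_one] at h'
      rcases h' with h' | ⟨i, h'⟩ | ⟨j, h'⟩
      exacts [⟨2 * a + 1, by rwa [ofFrac_two_mul_add_one]⟩, lift (ih h'), lift (ih h')]

/-- If `G ≤ x` fails, some `x^R ≤ G`, so `x ≤ G` and no right option of `G` is `≤ x`. Thus `x` fits.
-/
theorem le_ofFrac_or_exists_valEq {m : ℕ} {k : ℤ} {G : Game}
    (h : ∀ i, ¬ ofFrac m k ≤ G.left i) : G ≤ ofFrac m k ∨ ∃ j, G.ValEq (ofFrac m j) := by
  by_contra! hn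
  obtain ⟨h₁, h₂⟩ := hn
  rw [le_def] at h₁
  push Not at h₁
  obtain ⟨j, hj⟩ := h₁ h
  have hfit : Fits (ofFrac m k) G := ⟨h, fun j' h' => G.not_right_le j'
    (Game.le_trans h' (Game.le_trans ((ofFrac_numeric m k).le_right j) hj))⟩
  obtain ⟨a, ha⟩ := hfit.exists_valEq
  exact h₂ a ha

theorem ofFrac_le_or_exists_valEq {m : ℕ} {k : ℤ} {G : Game}
    (h : ∀ j, ¬ G.right j ≤ ofFrac m k) : ofFrac m k ≤ G ∨ ∃ j, G.ValEq (ofFrac m j) := by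
  by_contra! hn
  obtain ⟨h₁, h₂⟩ := hn
  have : ∃ i, G ≤ (ofFrac m k).left i := by
    by_contra! hi
    exact h₁ ((le_def _ _).2 ⟨hi, h⟩)
  obtain ⟨i, hi⟩ := this
  have hfit : Fits (ofFrac m k) G := ⟨fun i' h' => G.not_le_left i'
    (Game.le_trans hi (Game.le_trans ((ofFrac_numeric m k).left_le i) h')), h⟩
  obtain ⟨a, ha⟩ := hfit.exists_valEq
  exact h₂ a ha

end Game

end CGT

namespace CGT

open ZHalf

/-! ### Thermographs at the temperatures `-1 / 2 ^ m` -/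

namespace Game

/-- `λ` and `ρ` at the temperature `-1 / 2 ^ m` are multiples of `1 / 2 ^ m`, and they tell how `G`
compares with the multiples of `1 / 2 ^ m`. -/
structure DetectsAt (m : ℕ) (G : Game) : Prop where
  lam : ∃ a, G.lam (frac (-1) m) = frac a m ∧ ∀ k, G ≤ ofFrac m k ↔ a ≤ k
  rho : ∃ b, G.rho (frac (-1) m) = frac b m ∧ ∀ k, ofFrac m k ≤ G ↔ k ≤ b

/-- The shape of the thermograph of a game that is not equal to an integer, with `T` its
temperature. -/
structure HasMeet (G : Game) (T : ZHalf) : Prop where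
  numLeft_pos : 0 < G.numLeft
  numRight_pos : 0 < G.numRight
  wall_left : ∃ N, IsWall N G.lamTilde
  wall_right : ∃ N, IsWall N fun t => -G.rhoTilde t
  isLeast : IsLeast {t | G.lamTilde t = G.rhoTilde t} T
  lam_eq : ∀ t, G.lam t = G.lamTilde (min t T)
  rho_eq : ∀ t, G.rho t = G.rhoTilde (min t T)

theorem lam_of_eqInteger {G : Game} {n : ℤ} (h : G.ValEq (ofInt n)) (t : ZHalf) :
    G.lam t = n ∧ G.rho t = n := by
  have hG : G.EqInteger := ⟨n, h⟩
  have h1 := (h.symm.trans hG.choose_spec)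
  have h2 : n = hG.choose :=
    le_antisymm (ofFrac_le_ofFrac (m := 0).1 h1.1) (ofFrac_le_ofFrac (m := 0).1 h1.2)
  rw [lam, rho, thermo_of_eqInteger G hG]
  simp only [Thermo.ofInt, ← h2, and_self]

theorem detectsAt_of_valEq {m : ℕ} {G : Game} {a : ℤ} (h : G.ValEq (ofFrac m a))
    (hl : G.lam (frac (-1) m) = frac a m) (hr : G.rho (frac (-1) m) = frac a m) :
    G.DetectsAt m := by
  refine ⟨⟨a, hl, fun k => ?_⟩, ⟨a, hr, fun k => ?_⟩⟩
  · rw [← ofFrac_le_ofFrac (m := m)]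
    exact ⟨Game.le_trans h.2, Game.le_trans h.1⟩
  · rw [← ofFrac_le_ofFrac (m := m)]
    exact ⟨fun h' => Game.le_trans h' h.1, fun h' => Game.le_trans h' h.2⟩

theorem DetectsAt.valEq {m : ℕ} {G : Game} (h : G.DetectsAt m) {a : ℤ}
    (hl : G.lam (frac (-1) m) = frac a m) (hr : G.rho (frac (-1) m) = frac a m) :
    G.ValEq (ofFrac m a) := by
  obtain ⟨a', ha, h1⟩ := h.lam
  obtain ⟨b', hb, h2⟩ := h.rho
  rw [hl, frac_inj] at ha
  rw [hr, frac_inj] at hb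
  exact ⟨(h1 a).2 ha.ge, (h2 a).2 hb.le⟩

theorem exists_lamTilde_eq {m : ℕ} {G : Game} (hpos : 0 < G.numLeft)
    (h : ∀ i, (G.left i).DetectsAt m) :
    ∃ A, G.lamTilde (frac (-1) m) = frac A m ∧
      ∀ k, A ≤ k ↔ ∀ i, ¬ ofFrac m k ≤ G.left i := by
  choose b hb hk using fun i => (h i).rho
  obtain ⟨⟨i, hi⟩, hmax⟩ := maxOf_spec hpos fun i => (G.left i).rho (frac (-1) m) - frac (-1) m
  simp only [hb, ← frac_sub] at hi hmax
  rw [hi] at hmax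
  simp only [frac_le_frac] at hmax
  -- Cooling by `-1 / 2 ^ m` adds one grid unit, which turns the strict `b i < k` into `b i + 1 ≤
  -- k`.
  refine ⟨b i - -1, ?_, fun k => ?_⟩
  · simp only [lamTilde, hb, ← frac_sub, hi]
  · simp only [hk]
    exact ⟨fun h1 i' => by have := hmax i'; omega, fun h1 => by have := h1 i; omega⟩

theorem exists_rhoTilde_eq {m : ℕ} {G : Game} (hpos : 0 < G.numRight)
    (h : ∀ j, (G.right j).DetectsAt m) :
    ∃ B, G.rhoTilde (frac (-1) m) = frac B m ∧
      ∀ k, k ≤ B ↔ ∀ j, ¬ G.right j ≤ ofFrac m k := by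
  choose a ha hk using fun j => (h j).lam
  obtain ⟨⟨j, hj⟩, hmin⟩ := minOf_spec hpos fun j => (G.right j).lam (frac (-1) m) + frac (-1) m
  simp only [ha, ← frac_add] at hj hmin
  rw [hj] at hmin
  simp only [frac_le_frac] at hmin
  refine ⟨a j + -1, ?_, fun k => ?_⟩
  · simp only [rhoTilde, ha, ← frac_add, hj]
  · simp only [hk]
    exact ⟨fun h1 j' => by have := hmin j'; omega, fun h1 => by have := h1 j; omega⟩

/-- The comparison with options decides `G ≤ k / 2 ^ m` unless `G` equals some `j / 2 ^ m`; in that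
case `j ≤ B ≤ A ≤ k`. -/
theorem detectsAt_of_options {m : ℕ} {G : Game} {A B : ℤ}
    (hA : ∀ k, A ≤ k ↔ ∀ i, ¬ ofFrac m k ≤ G.left i)
    (hB : ∀ k, k ≤ B ↔ ∀ j, ¬ G.right j ≤ ofFrac m k) (hBA : B ≤ A)
    (hl : G.lam (frac (-1) m) = frac A m) (hr : G.rho (frac (-1) m) = frac B m) :
    G.DetectsAt m := by
  have h₁ : ∀ k, G ≤ ofFrac m k → A ≤ k := fun k h => (hA k).2 ((le_def _ _).1 h).1
  have h₂ : ∀ k, ofFrac m k ≤ G → k ≤ B := fun k h => (hB k).2 ((le_def _ _).1 h).2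
  refine ⟨⟨A, hl, fun k => ⟨h₁ k, fun hk => ?_⟩⟩, ⟨B, hr, fun k => ⟨h₂ k, fun hk => ?_⟩⟩⟩
  · rcases le_ofFrac_or_exists_valEq ((hA k).1 hk) with h | ⟨j, hj⟩
    · exact h
    · have := h₂ j hj.2
      exact Game.le_trans hj.1 (ofFrac_mono (by omega))
  · rcases ofFrac_le_or_exists_valEq ((hB k).1 hk) with h | ⟨j, hj⟩
    · exact h
    · have := h₁ j hj.1
      exact Game.le_trans (ofFrac_mono (by omega)) hj.2

theorem meet_eq {G : Game} {T : ZHalf}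
    (hT : IsLeast {t | G.lamTilde t = G.rhoTilde t} T) :
    Thermo.meet (fun i => (G.left i).thermo) (fun j => (G.right j).thermo) = T :=
  leastOf_eq hT

theorem temp_eq {G : Game} {T : ZHalf} (hG : ¬ G.EqInteger)
    (hT : IsLeast {t | G.lamTilde t = G.rhoTilde t} T) : G.temp = T := by
  rw [temp, thermo_of_not_eqInteger G hG]
  simp only [Thermo.ofOptions, meet_eq hT]

theorem lam_eq_lamTilde {G : Game} {T : ZHalf} (hG : ¬ G.EqInteger)
    (hT : IsLeast {t | G.lamTilde t = G.rhoTilde t} T) (t : ZHalf) :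
    G.lam t = G.lamTilde (min t T) := by
  rw [lam, thermo_of_not_eqInteger G hG]
  simp only [Thermo.ofOptions, meet_eq hT]
  split_ifs with h
  · rw [min_eq_left h]; rfl
  · rw [min_eq_right (not_le.1 h).le]; rfl

theorem rho_eq_rhoTilde {G : Game} {T : ZHalf} (hG : ¬ G.EqInteger)
    (hT : IsLeast {t | G.lamTilde t = G.rhoTilde t} T) (t : ZHalf) :
    G.rho t = G.rhoTilde (min t T) := by
  rw [rho, thermo_of_not_eqInteger G hG]
  simp only [Thermo.ofOptions, meet_eq hT]
  split_ifs with h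
  · rw [min_eq_left h]; rfl
  · rw [min_eq_right (not_le.1 h).le]; rfl

theorem cool_of_le {G : Game} {T t : ZHalf} (hG : ¬ G.EqInteger)
    (hT : IsLeast {t | G.lamTilde t = G.rhoTilde t} T) (h : t ≤ T) :
    G.cool t = mk _ _ (fun i => (G.left i).cool t - ofDyadic t)
      (fun j => (G.right j).cool t + ofDyadic t) := by
  rw [cool, thermo_of_not_eqInteger G hG]
  simp only [Thermo.ofOptions, meet_eq hT, if_pos h]
  rfl

theorem cool_of_gt {G : Game} {T t : ZHalf} (hG : ¬ G.EqInteger)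
    (hT : IsLeast {t | G.lamTilde t = G.rhoTilde t} T) (h : T < t) :
    G.cool t = ofDyadic (G.lamTilde T) := by
  rw [cool, thermo_of_not_eqInteger G hG]
  simp only [Thermo.ofOptions, meet_eq hT, if_neg h.not_ge]
  rfl

theorem isWall_lamTilde {G : Game} {N : ℕ} (hpos : 0 < G.numLeft)
    (h : ∀ i, IsWall N fun t => -(G.left i).rho t) : IsWall N G.lamTilde := by
  have := IsWall.max hpos fun i => (h i).neg_sub_id
  simp only [neg_neg] at this
  exact this

theorem isWall_rhoTilde {G : Game} {N : ℕ} (hpos : 0 < G.numRight)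
    (h : ∀ j, IsWall N (G.right j).lam) : IsWall N fun t => -G.rhoTilde t := by
  have := IsWall.max hpos fun i => (h i).neg_sub_id
  convert this using 2 with t
  rw [rhoTilde, neg_minOf hpos]
  simp only [neg_add']

/-- For `t ≥ 0` the left wall is at most `C - t` and the right one at least `D + t`, so they cross
for large `t`. -/
theorem exists_lamTilde_lt_rhoTilde {G : Game} (hl : 0 < G.numLeft) (hr : 0 < G.numRight)
    (hL : ∀ i, ∃ c, ∀ t, 0 ≤ t → (G.left i).rho t ≤ c)
    (hR : ∀ j, ∃ c, ∀ t, 0 ≤ t → c ≤ (G.right j).lam t) :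
    ∃ t, G.lamTilde t < G.rhoTilde t := by
  choose c hc using hL
  choose d hd using hR
  have hmax := (maxOf_spec hl c).2
  have hmin := (minOf_spec hr d).2
  set C := maxOf c
  set D := minOf d
  refine ⟨max 0 (C - D + 1), ?_⟩
  set t := max 0 (C - D + 1)
  have h0 : 0 ≤ t := le_max_left _ _
  have h1 : C - D + 1 ≤ t := le_max_right _ _
  obtain ⟨⟨i, hi⟩, -⟩ := maxOf_spec hl fun i => (G.left i).rho t - t
  obtain ⟨⟨j, hj⟩, -⟩ := minOf_spec hr fun j => (G.right j).lam t + t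
  rw [lamTilde, rhoTilde, hi, hj]
  have h2 := hc i t h0
  have h3 := hd j t h0
  have h4 := hmax i
  have h5 := hmin j
  linarith

/-- The facts about thermographs that are proved together by recursion. -/
structure Tame (G : Game) : Prop where
  lam : ∃ N, IsWall N G.lam
  rho : ∃ N, IsWall N fun t => -G.rho t
  rho_le_lam : ∀ t, G.rho t ≤ G.lam t
  detectsAt : G.DetectsAt 0
  hasMeet : ¬ G.EqInteger → ∃ T, frac (-1) 0 < T ∧ G.HasMeet T

theorem exists_forall_isWall {n : ℕ} {f : Fin n → ZHalf → ZHalf}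
    (h : ∀ i, ∃ N, IsWall N (f i)) : ∃ N, ∀ i, IsWall N (f i) := by
  choose N hN using h
  exact ⟨Finset.univ.sup N, fun i => (hN i).mono (Finset.le_sup (Finset.mem_univ i))⟩

theorem tame (G : Game) : G.Tame := by
  induction G using option_induction with
  | h G ihL ihR =>
  by_cases hG : G.EqInteger
  · obtain ⟨n, hn⟩ := hG
    have hl : G.lam = fun _ => (n : ZHalf) := funext fun t => (lam_of_eqInteger hn t).1
    have hr : G.rho = fun _ => (n : ZHalf) := funext fun t => (lam_of_eqInteger hn t).2
    refine ⟨⟨0, ?_⟩, ⟨0, ?_⟩, fun t => ?_, ?_, fun h => absurd ⟨n, hn⟩ h⟩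
    · rw [hl]
      exact .const (intCast_mem_grid n 0)
    · rw [hr]
      exact .const (neg_mem (intCast_mem_grid n 0))
    · rw [hl, hr]
    · exact detectsAt_of_valEq (a := n) hn (by simp only [hl, frac_zero_right])
        (by simp only [hr, frac_zero_right])
  · have nofit : ∀ k, ¬ Fits (ofFrac 0 k) G := fun k hk => hG hk.exists_valEq
    have hl : 0 < G.numLeft := by
      by_contra hl0
      choose a _ ha using fun j => (ihR j).detectsAt.lam
      -- Without left options, any integer less than every `a j` fits, so `G` would be an integer.
      refine nofit (-∑ j, |a j| - 1) ⟨fun i => absurd i.pos hl0, fun j h => ?_⟩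
      have h1 := (ha j _).1 h
      have h2 := Finset.single_le_sum (f := fun j => |a j|) (fun j _ => abs_nonneg _)
        (Finset.mem_univ j)
      have h3 := neg_abs_le (a j)
      linarith
    have hr : 0 < G.numRight := by
      by_contra hr0
      choose b _ hb using fun i => (ihL i).detectsAt.rho
      refine nofit (∑ i, |b i| + 1) ⟨fun i h => ?_, fun j => absurd j.pos hr0⟩
      have h1 := (hb i _).1 h
      have h2 := Finset.single_le_sum (f := fun i => |b i|) (fun i _ => abs_nonneg _)
        (Finset.mem_univ i)
      have h3 := le_abs_self (b i)
      linarith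
    obtain ⟨NL, hNL⟩ := exists_forall_isWall fun i => (ihL i).rho
    obtain ⟨NR, hNR⟩ := exists_forall_isWall fun j => (ihR j).lam
    have hwl := isWall_lamTilde hl fun i => (hNL i).mono (le_max_left NL NR)
    have hwr := isWall_rhoTilde hr fun j => (hNR j).mono (le_max_right NL NR)
    set N := max NL NR
    obtain ⟨A, hA, hA'⟩ := exists_lamTilde_eq hl fun i => (ihL i).detectsAt
    obtain ⟨B, hB, hB'⟩ := exists_rhoTilde_eq hr fun j => (ihR j).detectsAt
    -- Otherwise the integer `A` fits. Strictness places the temperature above `-1`.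
    have hBA : B < A := by
      by_contra! h
      exact nofit A ⟨(hA' A).1 le_rfl, (hB' A).1 h⟩
    have h₀ : G.rhoTilde (frac (-1) 0) < G.lamTilde (frac (-1) 0) := by
      rw [hA, hB, frac_lt_frac]
      exact hBA
    obtain ⟨t₁, h₁⟩ := exists_lamTilde_lt_rhoTilde hl hr
      (fun i => ⟨(G.left i).lam 0, fun t ht => ((ihL i).rho_le_lam t).trans
        ((ihL i).lam.choose_spec.antitone ht)⟩)
      (fun j => ⟨(G.right j).rho 0, fun t ht => le_trans
        (neg_le_neg_iff.1 ((ihR j).rho.choose_spec.antitone ht)) ((ihR j).rho_le_lam t)⟩)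
    have hanti := hwl.antitone_sub hwr
    obtain ⟨T, hTg, hT⟩ := hwl.exists_isLeast_meet hwr h₀ h₁
    have hTeq : G.lamTilde T = G.rhoTilde T := hT.1
    have hlt : frac (-1) 0 < T := by
      by_contra! h
      have := hanti h
      dsimp only at this
      linarith
    have hlam := lam_eq_lamTilde hG hT
    have hrho := rho_eq_rhoTilde hG hT
    refine ⟨⟨N + 1, ?_⟩, ⟨N + 1, ?_⟩, fun t => ?_, ?_,
      fun _ => ⟨T, hlt, hl, hr, ⟨N, hwl⟩, ⟨N, hwr⟩, hT, hlam, hrho⟩⟩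
    · have := (hwl.mono (Nat.le_succ N)).comp_min hTg
      rwa [← funext hlam] at this
    · have := (hwr.mono (Nat.le_succ N)).comp_min hTg
      simpa only [hrho] using this
    · rw [hlam, hrho]
      have := hanti (min_le_right t T)
      dsimp only at this
      linarith
    · exact detectsAt_of_options hA' hB' hBA.le
        (by rw [hlam, min_eq_left hlt.le, hA]) (by rw [hrho, min_eq_left hlt.le, hB])

theorem HasMeet.antitone_sub {G : Game} {T : ZHalf} (h : G.HasMeet T) :
    Antitone fun t => G.lamTilde t - G.rhoTilde t := by
  obtain ⟨N, hN⟩ := h.wall_left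
  obtain ⟨N', hN'⟩ := h.wall_right
  exact (hN.mono (le_max_left N N')).antitone_sub (hN'.mono (le_max_right N N'))

theorem HasMeet.lam_eq_rho_iff {G : Game} {T : ZHalf} (h : G.HasMeet T) (t : ZHalf) :
    G.lam t = G.rho t ↔ T ≤ t := by
  rw [h.lam_eq, h.rho_eq]
  refine ⟨fun h' => ?_, fun h' => ?_⟩
  · exact (h.isLeast.2 h').trans (min_le_left t T)
  · rw [min_eq_right h']
    exact h.isLeast.1

/-- Negative temperatures are of the form `-1 / 2 ^ m`. -/
theorem HasMeet.succ_le {G : Game} {T : ZHalf} {m : ℕ} (h : G.HasMeet T) (hd : G.DetectsAt m)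
    (hT : frac (-1) m < T) : frac (-1) (m + 1) ≤ T := by
  obtain ⟨N, hN⟩ := h.wall_left
  obtain ⟨N', hN'⟩ := h.wall_right
  obtain ⟨a, ha, -⟩ := hd.lam
  obtain ⟨b, hb, -⟩ := hd.rho
  have hne := mt (h.lam_eq_rho_iff (frac (-1) m)).1 hT.not_ge
  have hanti := h.antitone_sub hT.le
  have h1 := hN.monotone_add hT.le
  have h2 := hN'.monotone_add hT.le
  have h3 : G.lamTilde T = G.rhoTilde T := h.isLeast.1
  rw [ha, hb, frac_inj] at hne
  rw [h.lam_eq, min_eq_left hT.le] at ha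
  rw [h.rho_eq, min_eq_left hT.le] at hb
  dsimp only at hanti h1 h2
  rw [ha, hb] at hanti
  rw [ha] at h1
  rw [hb] at h2
  have hba : b ≤ a := by
    rw [← frac_le_frac (m := m)]
    linarith
  -- The walls differ at `-1 / 2 ^ m`, and both values are on the grid, so the gap is at least one
  -- unit. Each wall covers at most `T + 1 / 2 ^ m` of it up to `T`.
  have h4 := frac_le_frac (m := m).2 (show b + 1 ≤ a by omega)
  rw [frac_add] at h4
  rw [frac_neg] at h1 h2 ⊢
  have h5 := frac_one_succ m
  have h6 : (2 : ZHalf) * -frac 1 (m + 1) ≤ 2 * T := by linarith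
  linarith

theorem detectsAt (m : ℕ) (G : Game) : G.DetectsAt m := by
  induction m generalizing G with
  | zero => exact G.tame.detectsAt
  | succ m ih =>
    induction G using option_induction with
    | h G ihL ihR =>
    have hconst : ∀ a, G.lam (frac (-1) m) = frac a m → G.rho (frac (-1) m) = frac a m →
        G.lam (frac (-1) (m + 1)) = frac a m → G.rho (frac (-1) (m + 1)) = frac a m →
        G.DetectsAt (m + 1) := by
      intro a h1 h2 h3 h4
      have hv := (ih G).valEq h1 h2
      rw [← ofFrac_two_mul] at hv
      rw [← frac_two_mul a] at h3 h4
      exact detectsAt_of_valEq hv h3 h4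
    obtain ⟨a, ha, -⟩ := (ih G).lam
    by_cases hG : G.EqInteger
    · obtain ⟨n, hn⟩ := hG
      have h := lam_of_eqInteger hn
      rw [(h _).1] at ha
      exact hconst a (by rw [(h _).1, ha]) (by rw [(h _).2, ha]) (by rw [(h _).1, ha])
        (by rw [(h _).2, ha])
    · obtain ⟨T, -, hT⟩ := G.tame.hasMeet hG
      -- If `-1 / 2 ^ m` is already on the mast, `λ` and `ρ` stay constant from there on and the
      -- claim for `m` gives the value of `G`.
      rcases le_or_gt T (frac (-1) m) with hle | hgt
      · have h1 := (hT.lam_eq_rho_iff _).2 hle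
        have hmm : frac (-1) m ≤ frac (-1) (m + 1) := by
          rw [← frac_two_mul, frac_le_frac]
          norm_num
        have h2 : G.lam (frac (-1) (m + 1)) = G.lam (frac (-1) m) := by
          rw [hT.lam_eq, hT.lam_eq, min_eq_right hle, min_eq_right (hle.trans hmm)]
        have h3 := (hT.lam_eq_rho_iff _).2 (hle.trans hmm)
        exact hconst a ha (h1 ▸ ha) (h2.trans ha) (h3 ▸ h2.trans ha)
      · have hge := hT.succ_le (ih G) hgt
        obtain ⟨A, hA, hA'⟩ := exists_lamTilde_eq hT.numLeft_pos ihL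
        obtain ⟨B, hB, hB'⟩ := exists_rhoTilde_eq hT.numRight_pos ihR
        have hl : G.lam (frac (-1) (m + 1)) = frac A (m + 1) := by
          rw [hT.lam_eq, min_eq_left hge, hA]
        have hr : G.rho (frac (-1) (m + 1)) = frac B (m + 1) := by
          rw [hT.rho_eq, min_eq_left hge, hB]
        have hBA := G.tame.rho_le_lam (frac (-1) (m + 1))
        rw [hl, hr, frac_le_frac] at hBA
        exact detectsAt_of_options hA' hB' hBA hl hr

/-! ### Cooling by 0 and temperatures of numbers -/

theorem cool_zero_valEq (G : Game) : (G.cool 0).ValEq G := by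
  induction G using option_induction with
  | h G ihL ihR =>
  by_cases hG : G.EqInteger
  · rw [cool, thermo_of_eqInteger G hG]
    exact hG.choose_spec.symm
  · obtain ⟨T, -, hT⟩ := G.tame.hasMeet hG
    rcases le_or_gt 0 T with h | h
    · have hz : ofDyadic 0 = zero := by
        rw [← frac_zero_left 0, ofDyadic_frac]
        rfl
      rw [cool_of_le hG hT.isLeast h, hz]
      simp only [sub_zero, add_zero]
      exact mk_valEq G ihL ihR
    · rw [cool_of_gt hG hT.isLeast h]
      obtain ⟨m, hm⟩ := exists_frac_neg_one_ge h
      obtain ⟨a, ha, -⟩ := (detectsAt m G).lam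
      have h1 := (hT.lam_eq_rho_iff _).2 hm
      have h2 := (detectsAt m G).valEq ha (h1 ▸ ha)
      rw [hT.lam_eq, min_eq_right hm] at ha
      rw [ha, ofDyadic_frac]
      exact h2.symm

theorem temp_ofFrac_succ {k : ℤ} (hk : Odd k) (m : ℕ) :
    (ofFrac (m + 1) k).temp = (frac (-1) (m + 1) : ZHalf) := by
  set H := ofFrac (m + 1) k with hH
  have hne : ∀ a, ¬ H.ValEq (ofFrac m a) := by
    intro a h
    rw [← ofFrac_two_mul, hH] at h
    have h1 := ofFrac_le_ofFrac.1 h.1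
    have h2 := ofFrac_le_ofFrac.1 h.2
    obtain ⟨c, rfl⟩ := hk
    omega
  have hint : ¬ H.EqInteger := by
    rintro ⟨n, hn⟩
    rw [← ofFrac_mul_pow n m] at hn
    exact hne _ hn
  obtain ⟨T, -, hT⟩ := H.tame.hasMeet hint
  rw [temp_eq hint hT.isLeast]
  congr 1
  refine le_antisymm ?_ (hT.succ_le (detectsAt m H) ?_)
  -- Since `H = k / 2 ^ (m + 1)`, detection gives `a ≤ k ≤ b`, while `ρ ≤ λ` gives `b ≤ a`.
  · rw [← hT.lam_eq_rho_iff]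
    obtain ⟨a, ha, ha'⟩ := (detectsAt (m + 1) H).lam
    obtain ⟨b, hb, hb'⟩ := (detectsAt (m + 1) H).rho
    have h1 := (ha' k).1 H.le_refl
    have h2 := (hb' k).1 H.le_refl
    have h3 := H.tame.rho_le_lam (frac (-1) (m + 1))
    rw [ha, hb, frac_le_frac] at h3
    rw [ha, hb, frac_inj]
    omega
  -- With `-1 / 2 ^ m` on the mast, `H` would be a multiple of `1 / 2 ^ m`, contradicting that `k`
  -- is odd.
  · by_contra! hle
    obtain ⟨a, ha, -⟩ := (detectsAt m H).lam
    have h1 := (hT.lam_eq_rho_iff _).2 hle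
    exact hne a ((detectsAt m H).valEq ha (h1 ▸ ha))

end Game

end CGT

theorem proposition7p1 :
    (∀ G : CGT.Game, ¬ G.EqInteger →
      0 < G.numLeft ∧ 0 < G.numRight ∧
        ∃ T : CGT.ZHalf, IsLeast {t : CGT.ZHalf | G.lamTilde t = G.rhoTilde t} T ∧ G.temp = T) ∧
    (∀ G : CGT.Game, (G.cool 0).ValEq G) ∧
    (∀ (k : ℤ) (m : ℕ), Odd k → 1 ≤ m →
      (CGT.Game.ofDyadic (CGT.ZHalf.frac k m)).temp = (CGT.ZHalf.frac (-1) m : CGT.ZHalf)) := by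
  refine ⟨fun G hG => ?_, CGT.Game.cool_zero_valEq, fun k m hk hm => ?_⟩
  · obtain ⟨T, -, hT⟩ := G.tame.hasMeet hG
    exact ⟨hT.numLeft_pos, hT.numRight_pos, T, hT.isLeast, CGT.Game.temp_eq hG hT.isLeast⟩
  · obtain ⟨m, rfl⟩ := Nat.exists_eq_add_of_le' hm
    rw [CGT.Game.ofDyadic_frac]
    exact CGT.Game.temp_ofFrac_succ hk m
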